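/- Let $\mathcal B$ be a small category and let $\mathcal G=\mathrm{Set}^{\mathcal B}$ be the category of covariant functors $\mathcal B\to\mathrm{Set}$. Let $I$ be a (small) directed multigraph with vertex set $I_0$ and edge set $I_1$, and let $D$ be a diagram of shape $I$ in $\mathcal G$, that is, a graph morphism from $I$ to the underlying graph of $\mathcal G$: it has objects $D_i$ ($i\in I_0$) and morphisms $D_d:D_i\to D_j$ for the edges $d:i\to j$. Diagrams of shape $I$ with natural transformations (families $\tau_i:E_i\to D_i$ with $\tau_j\circ E_d=D_d\circ\tau_i$ for every edge $d:i\to j$) form a category $\mathcal G^I$. A natural transformation is *cartesian* if all its naturality squares are pullbacks, and $\mathcal G^I\Downarrow D$ denotes the full subcategory of the slice category $\mathcal G^I\downarrow D$ on the cartesian transformations into $D$. Let $\Delta S$ be the constant diagram at $S\in\mathcal G$, and let $\kappa:D\Rightarrow\Delta S$ be a colimiting (i.e. universal) cocone. Taking pullbacks along all the components $\kappa_i:D_i\to S$ defines a functor $\kappa^*:\mathcal G\downarrow S\to\mathcal G^I\Downarrow D$. The cocone $\kappa$ is *Van Kampen* if $\kappa^*$ is an equivalence of categories. For an object $X$ of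 $\mathcal B$, a *path segment* of sort $X$ is a triple $(y,\delta,y')$ in which $y,y'$ are elements of the disjoint union $\coprod_{i\in I_0}D_i(X)$ and either $\delta=d$ is an edge $d:i\to j$ with $y\in D_i(X)$ and $y'=(D_d)_X(y)\in D_j(X)$, or $\delta=d^{op}$ is the formal opposite of an edge $d:i\to j$ with $y'\in D_i(X)$ and $y=(D_d)_X(y')\in D_j(X)$. Two segments are *weakly equal* if they are equal or one is the reverse $(y',\delta^{op},y)$ of the other $(y,\delta,y')$, where $(d^{op})^{op}=d$. A *mapping path* of sort $X$ connecting $z$ with $z'$ is a finite sequence of segments $[(y_0,\delta_0,y_1),(y_1,\delta_1,y_2),\dots,(y_{n-1},\delta_{n-1},y_n)]$ with $y_0=z$ and $y_n=z'$; the empty sequence connects every element with itself. A mapping path is *proper* if no two of its segments at different positions are weakly equal. Two mapping paths are equal if they have the same length and agree segment by segment. **Theorem.** The colimiting cocone $\kappa:D\Rightarrow\Delta S$ is Van Kampen if and only if for all objects $X$ of $\mathcal B$, all $i,j\in I_0$ and all $z\in D_i(X)$, $z'\in D_j(X)$, there are no two different proper mapping paths in $D$ connecting $z$ and $z'$. 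-/

import Mathlib

universe w v u v₁ u₁

open CategoryTheory CategoryTheory.Limits

noncomputable section

namespace VKPath

section Diagrams

variable (I : Type u₁) [Quiver.{v₁} I] (C : Type u) [Category.{v} C]

/-- A diagram of shape the directed multigraph `I` in `C`: a graph morphism from `I` to the
underlying graph of `C`. -/
structure Diagram extends Prefunctor I C

variable {I C}

/-- A natural transformation between diagrams. -/
@[ext]
structure DiagramHom (E D : Diagram I C) where
  app : ∀ i : I, E.obj i ⟶ D.obj i
  naturality : ∀ {i j : I} (d : i ⟶ j), E.map d ≫ app j = app i ≫ D.map d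

/-- The category of diagrams of shape `I` in `C`. -/
instance : Category (Diagram I C) where
  Hom E D := DiagramHom E D
  id D := { app := fun i => 𝟙 (D.obj i), naturality := by simp }
  comp f g :=
    { app := fun i => f.app i ≫ g.app i
      naturality := fun d => by
        rw [← Category.assoc, f.naturality, Category.assoc, g.naturality, Category.assoc] }
  id_comp f := DiagramHom.ext (funext fun _ => Category.id_comp _)
  comp_id f := DiagramHom.ext (funext fun _ => Category.comp_id _)
  assoc f g h := DiagramHom.ext (funext fun _ => Category.assoc _ _ _)

/-- The constant diagram functor. -/
def constDiagram : C ⥤ Diagram I C where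
  obj S := { obj := fun _ => S, map := fun _ => 𝟙 S }
  map f := { app := fun _ => f, naturality := fun _ => by simp }
  map_id _ := rfl
  map_comp _ _ := rfl

/-- A natural transformation is cartesian if all its naturality squares are pullbacks. -/
def IsCartesian {E D : Diagram I C} (τ : E ⟶ D) : Prop :=
  ∀ ⦃i j : I⦄ (d : i ⟶ j), IsPullback (E.map d) (τ.app i) (τ.app j) (D.map d)

/-- The full subcategory of the slice over `D` on the cartesian natural transformations. -/
abbrev CartesianOver (D : Diagram I C) :=
  ObjectProperty.FullSubcategory (fun τ : Over D => IsCartesian τ.hom)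

variable {D : Diagram I C} {S : C}

/-- The component of a commutative cocone at `i`. -/
def leg (κ : D ⟶ constDiagram.obj S) (i : I) : D.obj i ⟶ S := κ.app i

theorem map_leg (κ : D ⟶ constDiagram.obj S) {i j : I} (d : i ⟶ j) :
    D.map d ≫ leg κ j = leg κ i :=
  (κ.naturality d).trans (Category.comp_id (leg κ i))

/-- A commutative cocone is colimiting if it is universal. -/
def IsColimiting (κ : D ⟶ constDiagram.obj S) : Prop :=
  ∀ (T : C) (ρ : D ⟶ constDiagram.obj T), ∃! u : S ⟶ T, κ ≫ constDiagram.map u = ρ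

variable [HasPullbacks C]

/-- The morphism between the pullbacks of `σ` along `κ_i` and `κ_j` induced by an edge. -/
def pullbackEdge (κ : D ⟶ constDiagram.obj S) (σ : Over S) {i j : I} (d : i ⟶ j) :
    pullback (leg κ i) σ.hom ⟶ pullback (leg κ j) σ.hom :=
  pullback.lift (pullback.fst (leg κ i) σ.hom ≫ D.map d) (pullback.snd (leg κ i) σ.hom)
    (by rw [Category.assoc, map_leg, pullback.condition])

@[simp]
theorem pullbackEdge_fst (κ : D ⟶ constDiagram.obj S) (σ : Over S) {i j : I} (d : i ⟶ j) :
    pullbackEdge κ σ d ≫ pullback.fst (leg κ j) σ.hom = pullback.fst (leg κ i) σ.hom ≫ D.map d :=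
  pullback.lift_fst _ _ _

@[simp]
theorem pullbackEdge_snd (κ : D ⟶ constDiagram.obj S) (σ : Over S) {i j : I} (d : i ⟶ j) :
    pullbackEdge κ σ d ≫ pullback.snd (leg κ j) σ.hom = pullback.snd (leg κ i) σ.hom :=
  pullback.lift_snd _ _ _

/-- The morphism between the pullbacks of `σ` and `σ'` along `κ_i` induced by `γ : σ ⟶ σ'`. -/
def pullbackComp (κ : D ⟶ constDiagram.obj S) {σ σ' : Over S} (γ : σ ⟶ σ') (i : I) :
    pullback (leg κ i) σ.hom ⟶ pullback (leg κ i) σ'.hom :=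
  pullback.lift (pullback.fst (leg κ i) σ.hom) (pullback.snd (leg κ i) σ.hom ≫ γ.left)
    (by rw [Category.assoc, Over.w γ, pullback.condition])

@[simp]
theorem pullbackComp_fst (κ : D ⟶ constDiagram.obj S) {σ σ' : Over S} (γ : σ ⟶ σ') (i : I) :
    pullbackComp κ γ i ≫ pullback.fst (leg κ i) σ'.hom = pullback.fst (leg κ i) σ.hom :=
  pullback.lift_fst _ _ _

@[simp]
theorem pullbackComp_snd (κ : D ⟶ constDiagram.obj S) {σ σ' : Over S} (γ : σ ⟶ σ') (i : I) :
    pullbackComp κ γ i ≫ pullback.snd (leg κ i) σ'.hom =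
      pullback.snd (leg κ i) σ.hom ≫ γ.left :=
  pullback.lift_snd _ _ _

/-- The diagram obtained by pulling back `σ : K ⟶ S` along all components of a cocone. -/
def pullbackDiagram (κ : D ⟶ constDiagram.obj S) (σ : Over S) : Diagram I C where
  obj i := pullback (leg κ i) σ.hom
  map d := pullbackEdge κ σ d

/-- The projections of the pulled back diagram to `D`. -/
def pullbackProj (κ : D ⟶ constDiagram.obj S) (σ : Over S) : pullbackDiagram κ σ ⟶ D where
  app i := pullback.fst (leg κ i) σ.hom
  naturality d := pullbackEdge_fst κ σ d

theorem isCartesian_pullbackProj (κ : D ⟶ constDiagram.obj S) (σ : Over S) :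
    IsCartesian (pullbackProj κ σ) := by
  intro i j d
  have hj := (IsPullback.of_hasPullback (leg κ j) σ.hom).flip
  have hi : IsPullback (pullbackEdge κ σ d ≫ pullback.snd (leg κ j) σ.hom)
      (pullback.fst (leg κ i) σ.hom) σ.hom (D.map d ≫ leg κ j) := by
    rw [pullbackEdge_snd, map_leg]
    exact (IsPullback.of_hasPullback (leg κ i) σ.hom).flip
  exact IsPullback.of_right hi (pullbackEdge_fst κ σ d) hj

/-- The natural transformation between pulled back diagrams induced by `γ : σ ⟶ σ'`. -/
def pullbackMap (κ : D ⟶ constDiagram.obj S) {σ σ' : Over S} (γ : σ ⟶ σ') :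
    pullbackDiagram κ σ ⟶ pullbackDiagram κ σ' where
  app i := pullbackComp κ γ i
  naturality {i j} d := by
    change pullbackEdge κ σ d ≫ pullbackComp κ γ j = pullbackComp κ γ i ≫ pullbackEdge κ σ' d
    apply pullback.hom_ext
    · rw [Category.assoc, Category.assoc, pullbackComp_fst, pullbackEdge_fst, pullbackEdge_fst,
        ← Category.assoc, pullbackComp_fst]
    · rw [Category.assoc, Category.assoc, pullbackComp_snd, pullbackEdge_snd, pullbackComp_snd,
        ← Category.assoc, pullbackEdge_snd]

/-- The functor that pulls back along all components of the cocone `κ`, from the slice over `S`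
to the cartesian natural transformations into `D`. -/
def pullbackFunctor (κ : D ⟶ constDiagram.obj S) : Over S ⥤ CartesianOver D where
  obj σ := ⟨Over.mk (pullbackProj κ σ), isCartesian_pullbackProj κ σ⟩
  map γ := ObjectProperty.homMk <| Over.homMk (pullbackMap κ γ)
    (DiagramHom.ext (funext fun i => pullbackComp_fst κ γ i))
  map_id σ := by
    apply ObjectProperty.hom_ext
    apply Over.OverMorphism.ext
    refine DiagramHom.ext (funext fun i => ?_)
    change pullbackComp κ (𝟙 σ) i = 𝟙 (pullback (leg κ i) σ.hom)
    apply pullback.hom_ext <;> simp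
  map_comp {σ σ' σ''} γ γ' := by
    apply ObjectProperty.hom_ext
    apply Over.OverMorphism.ext
    refine DiagramHom.ext (funext fun i => ?_)
    change pullbackComp κ (γ ≫ γ') i = pullbackComp κ γ i ≫ pullbackComp κ γ' i
    apply pullback.hom_ext
    · simp
    · rw [Category.assoc, pullbackComp_snd, pullbackComp_snd,
        ← Category.assoc, pullbackComp_snd, Category.assoc, Over.comp_left]

/-- A cocone is Van Kampen if pulling back along it is an equivalence of categories. -/
def IsVanKampen (κ : D ⟶ constDiagram.obj S) : Prop :=
  (pullbackFunctor κ).IsEquivalence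

end Diagrams

section MappingPaths

variable {B : Type w} [SmallCategory B] {I : Type w} [Quiver.{w} I]

/-- The disjoint union over `i` of the elements of sort `X` of the components `D_i`. -/
abbrev Elem (D : Diagram I (B ⥤ Type w)) (X : B) : Type w := Σ i : I, (D.obj i).obj X

/-- A path segment `(y, δ, y')` of sort `X`. The label `δ` is an edge `d` (`Sum.inl d`) or a
formal opposite `dᵒᵖ` of an edge (`Sum.inr d`). -/
structure PathSegment (D : Diagram I (B ⥤ Type w)) (X : B) where
  source : Elem D X
  label : Quiver.Total I ⊕ Quiver.Total I
  target : Elem D X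
  valid : match label with
    | Sum.inl d => ∃ x : (D.obj d.left).obj X,
        source = ⟨d.left, x⟩ ∧ target = ⟨d.right, (D.map d.hom).app X x⟩
    | Sum.inr d => ∃ x : (D.obj d.left).obj X,
        target = ⟨d.left, x⟩ ∧ source = ⟨d.right, (D.map d.hom).app X x⟩

variable {D : Diagram I (B ⥤ Type w)} {X : B}

/-- Weak equality: equal, or equal up to reversal. -/
def PathSegment.WeakEq (s t : PathSegment D X) : Prop :=
  s = t ∨ (s.source = t.target ∧ s.label = t.label.swap ∧ s.target = t.source)

/-- `Connects z P z'`: the sequence `P` of segments is a mapping path connecting `z` with `z'`. -/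
def Connects (z : Elem D X) : List (PathSegment D X) → Elem D X → Prop
  | [], z' => z = z'
  | s :: P, z' => s.source = z ∧ Connects s.target P z'

/-- A path is proper if the segments at any two different positions are not weakly equal. -/
def IsProper (P : List (PathSegment D X)) : Prop :=
  P.Pairwise fun s t => ¬ s.WeakEq t

end MappingPaths

end VKPath

end

/-!
Linkage of elements by mapping paths computes colimits of set-valued functors, and it lifts along
cartesian transformations. Hence colimits are universal, `κ*` is fully faithful, and only its
essential surjectivity is in question. A cartesian `τ : E ⟶ D` is pulled back along `κ` exactly if
its monodromy is trivial, that is, if no mapping path of `E` connects two distinct elements of the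
same fibre. So the claim is a statement about covering spaces: all coverings of `D` have trivial
monodromy if and only if `D` has no non-empty proper closed mapping path. In one direction, a path
of the covering is shortened, without changing its ends, until its projection is proper. In the
other direction, a proper closed path that starts with the segment `s` traverses `s` exactly once,
in either direction, so it lifts to a path that changes sheets in the double covering whose sheets
are exchanged along `s`.
-/

noncomputable section

namespace VKPath

section General

variable {I : Type u₁} [Quiver.{v₁} I] {C : Type u} [Category.{v} C] {E D : Diagram I C} {S T : C}

theorem Diagram.hom_ext {τ τ' : E ⟶ D} (h : ∀ i, τ.app i = τ'.app i) : τ = τ' :=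
  DiagramHom.ext (funext h)

/-- The isomorphism of diagrams assembled from a natural family of isomorphisms. -/
def Diagram.isoOfComponents (φ : ∀ i, E.obj i ≅ D.obj i)
    (naturality : ∀ {i j : I} (d : i ⟶ j), E.map d ≫ (φ j).hom = (φ i).hom ≫ D.map d) : E ≅ D where
  hom := { app := fun i => (φ i).hom, naturality := naturality }
  inv :=
    { app := fun i => (φ i).inv
      naturality := fun d => by
        rw [Iso.eq_inv_comp, ← Category.assoc, Iso.comp_inv_eq, naturality d] }
  hom_inv_id := Diagram.hom_ext fun i => (φ i).hom_inv_id
  inv_hom_id := Diagram.hom_ext fun i => (φ i).inv_hom_id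

variable (C) in
/-- The functor that sends a diagram to its object at a vertex. -/
def Diagram.evaluation (i : I) : Diagram I C ⥤ C where
  obj D := D.obj i
  map τ := τ.app i

theorem isCartesian_id (D : Diagram I C) : IsCartesian (𝟙 D) :=
  fun _ _ d => .id_vert (D.map d)

variable {κ : D ⟶ constDiagram.obj S}

theorem IsColimiting.hom_ext (hκ : IsColimiting κ) {f g : S ⟶ T}
    (h : ∀ i, leg κ i ≫ f = leg κ i ≫ g) : f = g :=
  (hκ T (κ ≫ constDiagram.map g)).unique (Diagram.hom_ext h) rfl

theorem IsColimiting.exists_desc (hκ : IsColimiting κ) (ρ : D ⟶ constDiagram.obj T) :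
    ∃ f : S ⟶ T, ∀ i, leg κ i ≫ f = leg ρ i := by
  obtain ⟨f, hf, -⟩ := hκ T ρ
  exact ⟨f, fun i => congrArg (leg · i) hf⟩

theorem IsColimiting.comp_iff_isIso (hκ : IsColimiting κ) (f : S ⟶ T) :
    IsColimiting (κ ≫ constDiagram.map f) ↔ IsIso f := by
  constructor
  · intro h
    obtain ⟨g, hg⟩ := h.exists_desc κ
    refine ⟨g, hκ.hom_ext fun i => ?_, h.hom_ext fun i => ?_⟩
    · rw [← Category.assoc, Category.comp_id]
      exact hg i
    · rw [← Category.assoc, hg, Category.comp_id]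
      rfl
  · intro _ U ρ
    obtain ⟨g, hg⟩ := hκ.exists_desc ρ
    refine ⟨inv f ≫ g, Diagram.hom_ext fun i => ?_, fun g' hg' => ?_⟩
    · change (leg κ i ≫ f) ≫ inv f ≫ g = leg ρ i
      rw [Category.assoc, IsIso.hom_inv_id_assoc, hg]
    · rw [IsIso.eq_inv_comp]
      refine hκ.hom_ext fun i => ?_
      rw [hg, ← Category.assoc]
      exact congrArg (leg · i) hg'

variable [HasPullbacks C]

/-- The cocone on the pulled back diagram given by the projections to the source of `σ`. -/
def pullbackCocone (κ : D ⟶ constDiagram.obj S) (σ : Over S) :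
    pullbackDiagram κ σ ⟶ constDiagram.obj σ.left where
  app i := pullback.snd (leg κ i) σ.hom
  naturality d := (pullbackEdge_snd κ σ d).trans (Category.comp_id _).symm

/-- Universality of the colimit `κ`: every pullback of `κ` is again colimiting. -/
def IsUniversallyColimiting (κ : D ⟶ constDiagram.obj S) : Prop :=
  ∀ σ : Over S, IsColimiting (pullbackCocone κ σ)

theorem IsUniversallyColimiting.faithful_pullbackFunctor (hκ : IsUniversallyColimiting κ) :
    (pullbackFunctor κ).Faithful where
  map_injective {σ σ'} γ γ' hγ := by
    refine Over.OverMorphism.ext ((hκ σ).hom_ext fun i => ?_)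
    have hi : pullbackComp κ γ i = pullbackComp κ γ' i :=
      congrArg (fun f : (pullbackFunctor κ).obj σ ⟶ (pullbackFunctor κ).obj σ' =>
        DiagramHom.app f.hom.left i) hγ
    exact (pullbackComp_snd κ γ i).symm.trans
      ((congrArg (· ≫ _) hi).trans (pullbackComp_snd κ γ' i))

theorem IsUniversallyColimiting.full_pullbackFunctor (hκ : IsUniversallyColimiting κ) :
    (pullbackFunctor κ).Full where
  map_surjective {σ σ'} θ := by
    let θ' : pullbackDiagram κ σ ⟶ pullbackDiagram κ σ' := θ.hom.left
    let t (i : I) : pullback (leg κ i) σ.hom ⟶ pullback (leg κ i) σ'.hom := θ'.app i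
    have t_fst (i : I) : t i ≫ pullback.fst (leg κ i) σ'.hom = pullback.fst (leg κ i) σ.hom :=
      congrArg (DiagramHom.app · i) (Over.w θ.hom)
    obtain ⟨γ, hγ⟩ := (hκ σ).exists_desc (θ' ≫ pullbackCocone κ σ')
    have snd_γ (i : I) :
        pullback.snd (leg κ i) σ.hom ≫ γ = t i ≫ pullback.snd (leg κ i) σ'.hom := hγ i
    have γ_over : γ ≫ σ'.hom = σ.hom := by
      refine (hκ σ).hom_ext fun i => ?_
      change pullback.snd (leg κ i) σ.hom ≫ γ ≫ σ'.hom = pullback.snd (leg κ i) σ.hom ≫ σ.hom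
      rw [← Category.assoc, snd_γ, Category.assoc, ← pullback.condition, ← Category.assoc, t_fst,
        pullback.condition]
    refine ⟨Over.homMk γ γ_over, ObjectProperty.hom_ext _ (Over.OverMorphism.ext
      (Diagram.hom_ext fun i => ?_))⟩
    change pullbackComp κ (Over.homMk γ γ_over) i = t i
    apply pullback.hom_ext
    · rw [pullbackComp_fst, t_fst]
    · exact (pullbackComp_snd _ _ _).trans (snd_γ i)

theorem exists_isPullback_of_mem_essImage {τ : CartesianOver D}
    (h : (pullbackFunctor κ).essImage τ) :
    ∃ (σ : Over S) (ρ : τ.obj.left ⟶ constDiagram.obj σ.left),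
      ∀ i, IsPullback (DiagramHom.app τ.obj.hom i) (leg ρ i) (leg κ i) σ.hom := by
  obtain ⟨σ, ⟨φ⟩⟩ := h
  let ψ : τ.obj.left ⟶ pullbackDiagram κ σ := φ.inv.hom.left
  refine ⟨σ, ψ ≫ pullbackCocone κ σ, fun i => ?_⟩
  let ψ_iso : τ.obj.left.obj i ≅ pullback (leg κ i) σ.hom :=
    (ObjectProperty.ι _ ⋙ Over.forget D ⋙ Diagram.evaluation C i).mapIso φ.symm
  have ψ_fst : ψ_iso.hom ≫ pullback.fst (leg κ i) σ.hom = DiagramHom.app τ.obj.hom i :=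
    congrArg (DiagramHom.app · i) (Over.w φ.inv.hom)
  have ψ_snd : ψ_iso.hom ≫ pullback.snd (leg κ i) σ.hom = leg (ψ ≫ pullbackCocone κ σ) i := rfl
  refine .of_iso_pullback ⟨?_⟩ ψ_iso ψ_fst ψ_snd
  rw [← ψ_fst, ← ψ_snd, Category.assoc, Category.assoc, pullback.condition]

theorem mem_essImage_of_isPullback {τ : CartesianOver D} {σ : Over S}
    (ρ : τ.obj.left ⟶ constDiagram.obj σ.left)
    (h : ∀ i, IsPullback (DiagramHom.app τ.obj.hom i) (leg ρ i) (leg κ i) σ.hom) :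
    (pullbackFunctor κ).essImage τ := by
  have naturality {i j : I} (d : i ⟶ j) : τ.obj.left.map d ≫ (h j).isoPullback.hom =
      (h i).isoPullback.hom ≫ pullbackEdge κ σ d := by
    apply pullback.hom_ext
    · rw [Category.assoc, Category.assoc, pullbackEdge_fst, IsPullback.isoPullback_hom_fst,
        IsPullback.isoPullback_hom_fst_assoc]
      exact DiagramHom.naturality τ.obj.hom d
    · rw [Category.assoc, Category.assoc, pullbackEdge_snd, IsPullback.isoPullback_hom_snd,
        IsPullback.isoPullback_hom_snd, map_leg]
  let φ : τ.obj.left ≅ pullbackDiagram κ σ :=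
    Diagram.isoOfComponents (fun i => (h i).isoPullback) naturality
  have φ_proj : φ.hom ≫ pullbackProj κ σ = τ.obj.hom :=
    Diagram.hom_ext fun i => (h i).isoPullback_hom_fst
  exact ⟨σ, ⟨ObjectProperty.isoMk _ (Over.isoMk φ φ_proj).symm⟩⟩

theorem IsUniversallyColimiting.isVanKampen_iff_exists_isPullback (hκ : IsUniversallyColimiting κ) :
    IsVanKampen κ ↔ ∀ ⦃E : Diagram I C⦄ (τ : E ⟶ D), IsCartesian τ →
      ∃ (σ : Over S) (ρ : E ⟶ constDiagram.obj σ.left),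
        ∀ i, IsPullback (DiagramHom.app τ i) (leg ρ i) (leg κ i) σ.hom := by
  constructor
  · intro (_ : (pullbackFunctor κ).IsEquivalence) E τ hτ
    exact exists_isPullback_of_mem_essImage
      (Functor.EssSurj.mem_essImage (F := pullbackFunctor κ) ⟨Over.mk τ, hτ⟩)
  · intro hpb
    have := hκ.faithful_pullbackFunctor
    have := hκ.full_pullbackFunctor
    have : (pullbackFunctor κ).EssSurj :=
      ⟨fun τ => let ⟨_, ρ, hρ⟩ := hpb τ.obj.hom τ.property; mem_essImage_of_isPullback ρ hρ⟩
    exact { }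

end General

variable {B : Type w} [SmallCategory B] {I : Type w} [Quiver.{w} I]
  {E D : Diagram I (B ⥤ Type w)} {S : B ⥤ Type w} {X : B}

section Paths

attribute [ext] PathSegment

/-- The segment `(x, d, D_d x)` of an edge `d` at an element `x`. -/
def PathSegment.forward {i j : I} (d : i ⟶ j) (x : (D.obj i).obj X) : PathSegment D X where
  source := ⟨i, x⟩
  label := Sum.inl ⟨i, j, d⟩
  target := ⟨j, (D.map d).app X x⟩
  valid := ⟨x, rfl, rfl⟩

/-- The reverse `(y', δᵒᵖ, y)` of the segment `(y, δ, y')`. -/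
def PathSegment.reverse (s : PathSegment D X) : PathSegment D X where
  source := s.target
  label := s.label.swap
  target := s.source
  valid := by obtain ⟨y, δ | δ, y', h⟩ := s <;> exact h

theorem PathSegment.exists_eq_forward_or_reverse (s : PathSegment D X) :
    ∃ (i j : I) (d : i ⟶ j) (x : (D.obj i).obj X), s = forward d x ∨ s = (forward d x).reverse := by
  obtain ⟨y, δ | δ, y', x, rfl, rfl⟩ := s
  · exact ⟨_, _, δ.hom, x, .inl rfl⟩
  · exact ⟨_, _, δ.hom, x, .inr rfl⟩

theorem PathSegment.reverse_reverse (s : PathSegment D X) : s.reverse.reverse = s :=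
  PathSegment.ext rfl (Sum.swap_swap _) rfl

theorem PathSegment.weakEq_iff {s t : PathSegment D X} : s.WeakEq t ↔ s = t ∨ s = t.reverse :=
  or_congr_right (PathSegment.ext_iff (y := t.reverse)).symm

theorem PathSegment.weakEq_reverse_iff {s t : PathSegment D X} :
    s.WeakEq t.reverse ↔ s.WeakEq t := by
  rw [weakEq_iff, weakEq_iff, reverse_reverse, or_comm]

theorem connects_append {y y' : Elem D X} {P Q : List (PathSegment D X)} :
    Connects y (P ++ Q) y' ↔ ∃ z, Connects y P z ∧ Connects z Q y' := by
  induction P generalizing y with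
  | nil => simp only [List.nil_append, Connects, exists_eq_left']
  | cons s P ih => simp only [List.cons_append, Connects, ih, and_assoc, exists_and_left]

theorem Connects.append {y₁ y₂ y₃ : Elem D X} {P Q : List (PathSegment D X)}
    (hP : Connects y₁ P y₂) (hQ : Connects y₂ Q y₃) : Connects y₁ (P ++ Q) y₃ :=
  connects_append.2 ⟨_, hP, hQ⟩

theorem Connects.reverse {y y' : Elem D X} {P : List (PathSegment D X)} (h : Connects y P y') :
    Connects y' (P.map PathSegment.reverse).reverse y := by
  induction P generalizing y with
  | nil => exact h.symm
  | cons s P ih =>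
    rw [List.map_cons, List.reverse_cons]
    exact (ih h.2).append ⟨rfl, h.1⟩

/-- Two elements are linked if some mapping path connects them. -/
def Linked (y y' : Elem D X) : Prop := ∃ P, Connects y P y'

variable (D X) in
/-- Linked elements form the fibres of the colimit of `D` at `X`. -/
def linkedSetoid : Setoid (Elem D X) where
  r := Linked
  iseqv :=
    { refl := fun _ => ⟨[], rfl⟩
      symm := fun ⟨_, hP⟩ => ⟨_, hP.reverse⟩
      trans := fun ⟨_, hP⟩ ⟨_, hQ⟩ => ⟨_, hP.append hQ⟩ }

theorem linked_map {i j : I} (d : i ⟶ j) (x : (D.obj i).obj X) :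
    Linked (D := D) ⟨i, x⟩ ⟨j, (D.map d).app X x⟩ :=
  ⟨[.forward d x], rfl, rfl⟩

theorem linkedSetoid_le {r : Setoid (Elem D X)}
    (h : ∀ ⦃i j : I⦄ (d : i ⟶ j) (x : (D.obj i).obj X), r ⟨i, x⟩ ⟨j, (D.map d).app X x⟩) :
    linkedSetoid D X ≤ r := by
  rintro y y' ⟨P, hP⟩
  induction P generalizing y with
  | nil => exact hP ▸ r.refl _
  | cons s P ih =>
    obtain ⟨rfl, hP⟩ := hP
    refine r.trans ?_ (ih hP)
    obtain ⟨i, j, d, x, rfl | rfl⟩ := s.exists_eq_forward_or_reverse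
    · exact h d x
    · exact r.symm (h d x)

end Paths

section Components

/-- The action of a morphism of `B` on elements. -/
def elemRestrict {Y : B} (f : X ⟶ Y) (y : Elem D X) : Elem D Y :=
  ⟨y.1, (D.obj y.1).map f y.2⟩

theorem Linked.restrict {Y : B} (f : X ⟶ Y) {y y' : Elem D X} (h : Linked y y') :
    Linked (elemRestrict f y) (elemRestrict f y') := by
  refine linkedSetoid_le (r := (linkedSetoid D Y).comap (elemRestrict f)) (fun i j d x => ?_) h
  have := linked_map d ((D.obj i).map f x)
  rwa [NatTrans.naturality_apply] at this

/-- The colimit of `D`: the functor of elements up to linkage. -/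
def components (D : Diagram I (B ⥤ Type w)) : B ⥤ Type w where
  obj X := Quotient (linkedSetoid D X)
  map f := ↾ Quotient.map (elemRestrict f) fun _ _ h => h.restrict f
  map_id X := by
    ext ⟨y⟩
    exact congrArg (Quotient.mk _) (Sigma.ext rfl (heq_of_eq (by simp [elemRestrict])))
  map_comp f g := by
    ext ⟨y⟩
    exact congrArg (Quotient.mk _) (Sigma.ext rfl (heq_of_eq (Functor.map_comp_apply _ _ _ _)))

/-- The cocone that sends an element to its class. -/
def toComponents (D : Diagram I (B ⥤ Type w)) : D ⟶ constDiagram.obj (components D) where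
  app i :=
    { app := fun X => ↾ fun x => ⟦⟨i, x⟩⟧
      naturality := fun _ _ _ => rfl }
  naturality d := by
    ext X x
    exact (Quotient.sound (linked_map d x)).symm

/-- A cocone as a function on elements. -/
def coconeMap (κ : D ⟶ constDiagram.obj S) (y : Elem D X) : S.obj X :=
  (leg κ y.1).app X y.2

theorem Linked.coconeMap_eq (κ : D ⟶ constDiagram.obj S) {y y' : Elem D X} (h : Linked y y') :
    coconeMap κ y = coconeMap κ y' :=
  linkedSetoid_le (r := Setoid.ker (coconeMap κ))
    (fun _ _ d x => (ConcreteCategory.congr_hom (congr_app (map_leg κ d) X) x).symm) h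

/-- The morphism from the colimit of `D` induced by a cocone. -/
def componentsDesc (κ : D ⟶ constDiagram.obj S) : components D ⟶ S where
  app X := ↾ Quotient.lift (coconeMap κ) fun _ _ h => h.coconeMap_eq κ
  naturality X Y f := by
    ext ⟨y⟩
    exact NatTrans.naturality_apply (leg κ y.1) f y.2

theorem toComponents_desc (κ : D ⟶ constDiagram.obj S) :
    toComponents D ≫ constDiagram.map (componentsDesc κ) = κ :=
  rfl

theorem isColimiting_toComponents (D : Diagram I (B ⥤ Type w)) : IsColimiting (toComponents D) := by
  refine fun T ρ => ⟨componentsDesc ρ, toComponents_desc ρ, fun u hu => ?_⟩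
  ext X ⟨y⟩
  exact congrArg (coconeMap · y) hu

theorem isColimiting_iff {κ : D ⟶ constDiagram.obj S} :
    IsColimiting κ ↔ ∀ X, Function.Surjective (coconeMap κ (X := X)) ∧
      ∀ ⦃y y' : Elem D X⦄, coconeMap κ y = coconeMap κ y' → Linked y y' := by
  rw [← toComponents_desc κ, (isColimiting_toComponents D).comp_iff_isIso, toComponents_desc,
    NatTrans.isIso_iff_isIso_app]
  refine forall_congr' fun X => ?_
  rw [isIso_iff_bijective, Function.Bijective, and_comm]
  refine and_congr (Quotient.mk_surjective.of_comp_iff ((componentsDesc κ).app X)).symm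
    ⟨fun h y y' hy => Quotient.exact (@h ⟦y⟧ ⟦y'⟧ hy), ?_⟩
  rintro h ⟨y⟩ ⟨y'⟩ hy
  exact Quotient.sound (h hy)

end Components

section Lifting

/-- A transformation of diagrams as a function on elements. -/
def elemMap (τ : E ⟶ D) (e : Elem E X) : Elem D X :=
  ⟨e.1, (τ.app e.1).app X e.2⟩

theorem elemMap_eq_mk_iff {τ : E ⟶ D} {i : I} {e : Elem E X} {x : (D.obj i).obj X} :
    elemMap τ e = ⟨i, x⟩ ↔ ∃ a : (E.obj i).obj X, e = ⟨i, a⟩ ∧ (τ.app i).app X a = x := by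
  obtain ⟨j, a⟩ := e
  constructor
  · intro h
    obtain ⟨rfl, hx⟩ := Sigma.mk.inj h
    exact ⟨a, rfl, eq_of_heq hx⟩
  · rintro ⟨b, hb, rfl⟩
    cases hb
    rfl

theorem app_map_apply (τ : E ⟶ D) {i j : I} (d : i ⟶ j) (x : (E.obj i).obj X) :
    (τ.app j).app X ((E.map d).app X x) = (D.map d).app X ((τ.app i).app X x) :=
  ConcreteCategory.congr_hom (congr_app (τ.naturality d) X) x

/-- The image of a segment under a transformation of diagrams. -/
def PathSegment.map (τ : E ⟶ D) (s : PathSegment E X) : PathSegment D X where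
  source := elemMap τ s.source
  label := s.label
  target := elemMap τ s.target
  valid := by
    obtain ⟨i, j, d, x, rfl | rfl⟩ := s.exists_eq_forward_or_reverse <;>
      exact ⟨(τ.app i).app X x, rfl, congrArg (Sigma.mk j) (app_map_apply τ d x)⟩

theorem PathSegment.map_forward (τ : E ⟶ D) {i j : I} (d : i ⟶ j) (x : (E.obj i).obj X) :
    (forward d x).map τ = forward d ((τ.app i).app X x) :=
  PathSegment.ext rfl rfl (congrArg (Sigma.mk j) (app_map_apply τ d x))

theorem Connects.map (τ : E ⟶ D) {e e' : Elem E X} {P : List (PathSegment E X)}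
    (h : Connects e P e') : Connects (elemMap τ e) (P.map (PathSegment.map τ)) (elemMap τ e') := by
  induction P generalizing e with
  | nil => exact congrArg _ h
  | cons s P ih => exact ⟨congrArg (elemMap τ) h.1, ih h.2⟩

theorem IsCartesian.exists_segment_lift {τ : E ⟶ D} (hτ : IsCartesian τ) (s : PathSegment D X)
    {e : Elem E X} (he : elemMap τ e = s.source) :
    ∃ t : PathSegment E X, t.source = e ∧ t.map τ = s := by
  obtain ⟨i, j, d, x, rfl | rfl⟩ := s.exists_eq_forward_or_reverse
  · obtain ⟨a, rfl, rfl⟩ := elemMap_eq_mk_iff.1 he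
    exact ⟨.forward d a, rfl, PathSegment.map_forward τ d a⟩
  · obtain ⟨b, rfl, hb⟩ := elemMap_eq_mk_iff.1 he
    obtain ⟨a, rfl, rfl⟩ := Types.exists_of_isPullback ((hτ d).app X) b x hb
    exact ⟨(PathSegment.forward d a).reverse, rfl,
      congrArg PathSegment.reverse (PathSegment.map_forward τ d a)⟩

theorem IsCartesian.exists_path_lift {τ : E ⟶ D} (hτ : IsCartesian τ) {P : List (PathSegment D X)}
    {e : Elem E X} {y' : Elem D X} (h : Connects (elemMap τ e) P y') :
    ∃ e' Q, Connects e Q e' ∧ elemMap τ e' = y' ∧ Q.map (PathSegment.map τ) = P := by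
  induction P generalizing e with
  | nil => exact ⟨e, [], rfl, h, rfl⟩
  | cons s P ih =>
    obtain ⟨t, rfl, rfl⟩ := hτ.exists_segment_lift s h.1.symm
    obtain ⟨e', Q, hQ, he', rfl⟩ := ih h.2
    exact ⟨e', t :: Q, ⟨rfl, hQ⟩, he', rfl⟩

theorem IsCartesian.exists_linked_lift {τ : E ⟶ D} (hτ : IsCartesian τ) {e : Elem E X}
    {y' : Elem D X} (h : Linked (elemMap τ e) y') : ∃ e', Linked e e' ∧ elemMap τ e' = y' := by
  obtain ⟨P, hP⟩ := h
  obtain ⟨e', Q, hQ, he', -⟩ := hτ.exists_path_lift hP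
  exact ⟨e', ⟨Q, hQ⟩, he'⟩

theorem IsCartesian.segment_eq_of_map_eq {τ : E ⟶ D} (hτ : IsCartesian τ) {s t : PathSegment E X}
    (h : s.map τ = t.map τ) (htarget : s.target = t.target) : s = t := by
  obtain ⟨hsource, hlabel, -⟩ := PathSegment.ext_iff.1 h
  refine PathSegment.ext ?_ hlabel htarget
  change s.label = t.label at hlabel
  obtain ⟨i, j, d, x, rfl | rfl⟩ := s.exists_eq_forward_or_reverse <;>
    obtain ⟨i', j', d', x', rfl | rfl⟩ := t.exists_eq_forward_or_reverse <;>
    cases hlabel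
  · have hx : (τ.app i).app X x = (τ.app i).app X x' := sigma_mk_injective (i := i) hsource
    have hdx : (E.map d).app X x = (E.map d).app X x' := sigma_mk_injective (i := j) htarget
    exact congrArg (Sigma.mk i) (Types.ext_of_isPullback ((hτ d).app X) hdx hx)
  · obtain rfl : x = x' := sigma_mk_injective (i := i) htarget
    rfl

end Lifting

section Universality

variable {κ : D ⟶ constDiagram.obj S}

theorem eq_of_isPullback_of_coconeMap_eq {τ : E ⟶ D} {K : B ⥤ Type w} {ρ : E ⟶ constDiagram.obj K}
    {σ : K ⟶ S} (h : ∀ i, IsPullback (DiagramHom.app τ i) (leg ρ i) (leg κ i) σ) {e e' : Elem E X}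
    (hρ : coconeMap ρ e = coconeMap ρ e') (hτ : elemMap τ e = elemMap τ e') : e = e' := by
  obtain ⟨i, a⟩ := e
  obtain ⟨b, rfl, hb⟩ := elemMap_eq_mk_iff.1 hτ.symm
  exact congrArg (Sigma.mk i) (Types.ext_of_isPullback ((h i).app X) hb.symm hρ)

theorem IsColimiting.isUniversallyColimiting (hκ : IsColimiting κ) :
    IsUniversallyColimiting κ := by
  intro σ
  refine isColimiting_iff.2 fun X => ⟨fun k => ?_, fun p q hpq => ?_⟩
  · obtain ⟨⟨i, x⟩, hx⟩ := (isColimiting_iff.1 hκ X).1 (σ.hom.app X k)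
    obtain ⟨p, -, hp⟩ :=
      Types.exists_of_isPullback ((IsPullback.of_hasPullback (leg κ i) σ.hom).app X) x k hx
    exact ⟨⟨i, p⟩, hp⟩
  · have coconeMap_proj (r : Elem (pullbackDiagram κ σ) X) :
        coconeMap κ (elemMap (pullbackProj κ σ) r) =
          σ.hom.app X (coconeMap (pullbackCocone κ σ) r) :=
      ConcreteCategory.congr_hom
        (congr_app (pullback.condition (f := leg κ r.1) (g := σ.hom)) X) r.2
    have proj_linked :
        Linked (elemMap (pullbackProj κ σ) p) (elemMap (pullbackProj κ σ) q) :=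
      (isColimiting_iff.1 hκ X).2 (by rw [coconeMap_proj, coconeMap_proj, hpq])
    obtain ⟨r, hpr, hr⟩ := (isCartesian_pullbackProj κ σ).exists_linked_lift proj_linked
    have hrq : r = q := eq_of_isPullback_of_coconeMap_eq
      (fun i => IsPullback.of_hasPullback (leg κ i) σ.hom)
      ((hpr.coconeMap_eq (pullbackCocone κ σ)).symm.trans hpq) hr
    exact hrq ▸ hpr

/-- Triviality of the monodromy of `τ`: no mapping path connects two distinct elements of the same
fibre. -/
def HasTrivialMonodromy (τ : E ⟶ D) : Prop :=
  ∀ ⦃X : B⦄ ⦃e e' : Elem E X⦄, Linked e e' → elemMap τ e = elemMap τ e' → e = e'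

theorem IsColimiting.isPullback_of_hasTrivialMonodromy (hκ : IsColimiting κ) {τ : E ⟶ D}
    (hτ : IsCartesian τ) (h : HasTrivialMonodromy τ) (i : I) :
    IsPullback (DiagramHom.app τ i) (leg (toComponents E) i) (leg κ i)
      (componentsDesc (τ ≫ κ)) := by
  refine .of_forall_isPullback_app fun X => (Types.isPullback_iff _ _ _ _).2 ⟨rfl, ?_, ?_⟩
  · rintro a b ⟨hab, hab'⟩
    exact sigma_mk_injective (i := i) (h (Quotient.exact hab') (congrArg (Sigma.mk i) hab))
  · rintro x ⟨e⟩ hx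
    obtain ⟨e', hee', he'⟩ := hτ.exists_linked_lift (e := e) (y' := ⟨i, x⟩)
      ((isColimiting_iff.1 hκ X).2 hx.symm)
    obtain ⟨a, rfl, ha⟩ := elemMap_eq_mk_iff.1 he'
    exact ⟨a, ha, (Quotient.sound hee').symm⟩

theorem IsColimiting.isVanKampen_iff_hasTrivialMonodromy (hκ : IsColimiting κ) :
    IsVanKampen κ ↔ ∀ ⦃E : Diagram I (B ⥤ Type w)⦄ (τ : E ⟶ D), IsCartesian τ →
      HasTrivialMonodromy τ := by
  rw [hκ.isUniversallyColimiting.isVanKampen_iff_exists_isPullback]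
  refine forall₃_congr fun E τ hτ => ⟨?_, fun h => ?_⟩
  · rintro ⟨σ, ρ, hρ⟩ X e e' hee'
    exact eq_of_isPullback_of_coconeMap_eq hρ (hee'.coconeMap_eq ρ)
  · exact ⟨Over.mk (componentsDesc (τ ≫ κ)), toComponents E,
      hκ.isPullback_of_hasTrivialMonodromy hτ h⟩

end Universality

section Acyclicity

variable (D) in
/-- A diagram is acyclic if its only proper closed mapping paths are the empty ones. -/
def IsAcyclic : Prop :=
  ∀ ⦃X : B⦄ ⦃y : Elem D X⦄ ⦃P : List (PathSegment D X)⦄, Connects y P y → IsProper P → P = []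

theorem IsAcyclic.exists_proper_map (hD : IsAcyclic D) {τ : E ⟶ D} (hτ : IsCartesian τ)
    {e e' : Elem E X} {P : List (PathSegment E X)} (h : Connects e P e') :
    ∃ Q ⊆ P, Connects e Q e' ∧ IsProper (Q.map (PathSegment.map τ)) := by
  induction P generalizing e with
  | nil => exact ⟨[], List.Subset.refl _, h, .nil⟩
  | cons s P ih =>
    obtain ⟨rfl, h⟩ := h
    obtain ⟨Q, hQP, hQ, hQ_proper⟩ := ih h
    by_cases hs : ∀ t ∈ Q, ¬ (s.map τ).WeakEq (t.map τ)
    · exact ⟨s :: Q, List.cons_subset_cons s hQP, ⟨rfl, hQ⟩,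
        .cons (List.forall_mem_map.2 hs) hQ_proper⟩
    push Not at hs
    obtain ⟨t, ht, hst⟩ := hs
    obtain ⟨Q₁, Q₂, rfl⟩ := List.append_of_mem ht
    obtain ⟨_, hQ₁, rfl, hQ₂⟩ := connects_append.1 hQ
    obtain hst | hst := PathSegment.weakEq_iff.1 hst
    · have hclosed : Connects (t.map τ).target ((Q₁ ++ [t]).map (PathSegment.map τ))
          (t.map τ).target := by
        nth_rw 1 [← hst]
        exact (hQ₁.append (Q := [t]) ⟨rfl, rfl⟩).map τ
      have hsublist : (Q₁ ++ [t]).Sublist (Q₁ ++ t :: Q₂) := by simp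
      simpa using hD hclosed (hQ_proper.sublist (hsublist.map _))
    · have htarget : (s.map τ).target = (t.map τ).source := congrArg PathSegment.target hst
      have hclosed : Connects (s.map τ).target (Q₁.map (PathSegment.map τ)) (s.map τ).target := by
        nth_rw 2 [htarget]
        exact hQ₁.map τ
      obtain rfl : Q₁ = [] := List.map_eq_nil_iff.1
        (hD hclosed (hQ_proper.sublist ((List.sublist_append_left _ _).map _)))
      obtain rfl : s = t.reverse := hτ.segment_eq_of_map_eq hst hQ₁
      exact ⟨Q₂, fun q hq => .tail _ (hQP (.tail _ hq)), hQ₂, hQ_proper.of_cons⟩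

theorem IsAcyclic.hasTrivialMonodromy (hD : IsAcyclic D) {τ : E ⟶ D} (hτ : IsCartesian τ) :
    HasTrivialMonodromy τ := by
  rintro X e e' ⟨P, hP⟩ hee'
  obtain ⟨Q, -, hQ, hQ_proper⟩ := hD.exists_proper_map hτ hP
  have hclosed : Connects (elemMap τ e) (Q.map (PathSegment.map τ)) (elemMap τ e) := by
    nth_rw 2 [hee']
    exact hQ.map τ
  obtain rfl : Q = [] := List.map_eq_nil_iff.1 (hD hclosed hQ_proper)
  exact hQ

theorem IsAcyclic.exists_proper_subset (hD : IsAcyclic D) {y y' : Elem D X}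
    {P : List (PathSegment D X)} (h : Connects y P y') :
    ∃ Q ⊆ P, Connects y Q y' ∧ IsProper Q := by
  have map_id : PathSegment.map (X := X) (𝟙 D) = id := rfl
  simpa only [map_id, List.map_id] using hD.exists_proper_map (isCartesian_id D) h

theorem IsAcyclic.eq_of_isProper (hD : IsAcyclic D) {y y' : Elem D X}
    {P Q : List (PathSegment D X)} (hP : Connects y P y') (hP_proper : IsProper P)
    (hQ : Connects y Q y') (hQ_proper : IsProper Q) : P = Q := by
  induction P generalizing y Q with
  | nil =>
    cases hP
    exact (hD hQ hQ_proper).symm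
  | cons s P ih =>
    obtain ⟨rfl, hP⟩ := hP
    obtain ⟨hsP, hP_proper⟩ := List.pairwise_cons.1 hP_proper
    by_cases hs : ∀ t ∈ Q, ¬ s.WeakEq t
    · obtain ⟨R, hR_subset, hR, hR_proper⟩ := hD.exists_proper_subset (hP.append hQ.reverse)
      have hsR : ∀ r ∈ R, ¬ s.WeakEq r := by
        intro r hr
        obtain hr | hr := List.mem_append.1 (hR_subset hr)
        · exact hsP r hr
        · obtain ⟨t, ht, rfl⟩ := List.mem_map.1 (List.mem_reverse.1 hr)
          exact PathSegment.weakEq_reverse_iff.not.2 (hs t ht)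
      have hclosed : Connects s.source (s :: R) s.source := ⟨rfl, hR⟩
      exact absurd (hD hclosed (.cons hsR hR_proper)) (List.cons_ne_nil s R)
    · push Not at hs
      obtain ⟨t, ht, hst⟩ := hs
      obtain ⟨Q₁, Q₂, rfl⟩ := List.append_of_mem ht
      obtain ⟨_, hQ₁, rfl, hQ₂⟩ := connects_append.1 hQ
      obtain rfl | rfl := PathSegment.weakEq_iff.1 hst
      · obtain rfl : Q₁ = [] := hD hQ₁ (hQ_proper.sublist (List.sublist_append_left _ _))
        exact congrArg (s :: ·) (ih hP hP_proper hQ₂ hQ_proper.of_cons)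
      · have hclosed : Connects t.target (Q₁ ++ [t]) t.target := hQ₁.append ⟨rfl, rfl⟩
        have hsublist : (Q₁ ++ [t]).Sublist (Q₁ ++ t :: Q₂) := by simp
        simpa using hD hclosed (hQ_proper.sublist hsublist)

theorem isAcyclic_iff_proper_path_unique :
    IsAcyclic D ↔ ∀ ⦃X : B⦄ ⦃y y' : Elem D X⦄ ⦃P Q : List (PathSegment D X)⦄,
      Connects y P y' → IsProper P → Connects y Q y' → IsProper Q → P = Q :=
  ⟨fun hD _ _ _ _ _ => hD.eq_of_isProper, fun h _ _ _ hP hP_proper => h hP hP_proper rfl .nil⟩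

end Acyclicity

section Twist

variable {A : Type} [AddGroup A]

/-- The covering of `D` with voltages `c` on the path segments of sort `X`: a fibre over an
element of sort `X` carries a copy of `A`, which the edges translate by their voltage. Restricting
along morphisms of `B` forces the fibre over an element `x` of sort `Y` to have one coordinate for
each restriction of `x` to `X`. -/
def twist (c : PathSegment D X → A) : Diagram I (B ⥤ Type w) where
  obj i :=
    { obj := fun Y => (D.obj i).obj Y × ((Y ⟶ X) → A)
      map := fun g => ↾ fun p => ((D.obj i).map g p.1, fun f => p.2 (g ≫ f))
      map_id := fun Y => by ext p <;> simp
      map_comp := fun f g => by ext p <;> simp }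
  map {i j} d :=
    { app := fun Y => ↾ fun p =>
        ((D.map d).app Y p.1, fun f => p.2 f + c (.forward d ((D.obj i).map f p.1)))
      naturality := fun Y Z g => by
        ext p
        · exact NatTrans.naturality_apply (D.map d) g p.1
        · next f =>
          change p.2 (g ≫ f) + c (.forward d ((D.obj i).map f ((D.obj i).map g p.1))) =
            p.2 (g ≫ f) + c (.forward d ((D.obj i).map (g ≫ f) p.1))
          rw [Functor.map_comp_apply] }

/-- The projection of the covering with voltages `c`. -/
def twistProj (c : PathSegment D X → A) : twist c ⟶ D where
  app _ := { app := fun Y => ↾ fun p : _ × ((Y ⟶ X) → A) => p.1, naturality := fun _ _ _ => rfl }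
  naturality _ := rfl

theorem isCartesian_twistProj (c : PathSegment D X → A) : IsCartesian (twistProj c) := by
  refine fun i j d => .of_forall_isPullback_app fun Y =>
    (Types.isPullback_iff _ _ _ _).2 ⟨rfl, ?_, ?_⟩
  · rintro ⟨x, φ⟩ ⟨x', φ'⟩ ⟨h, hx⟩
    obtain rfl : x = x' := hx
    exact Prod.ext rfl (funext fun f => add_right_cancel (congrFun (congrArg Prod.snd h) f))
  · rintro ⟨y, φ⟩ x hx
    obtain rfl : y = (D.map d).app Y x := hx
    exact ⟨(x, fun f => φ f - c (.forward d ((D.obj i).map f x))),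
      Prod.ext rfl (funext fun _ => sub_add_cancel _ _), rfl⟩

/-- The coordinate in the copy of `A` over an element of sort `X`. -/
def sheet {c : PathSegment D X → A} (e : Elem (twist c) X) : A :=
  e.2.2 (𝟙 X)

variable {c : PathSegment D X → A}

theorem sheet_target (hc : ∀ s, c s.reverse = -c s) (t : PathSegment (twist c) X) :
    sheet t.target = sheet t.source + c (t.map (twistProj c)) := by
  have sheet_forward {i j : I} (d : i ⟶ j) (p : ((twist c).obj i).obj X) :
      sheet (PathSegment.forward d p).target =
        sheet (PathSegment.forward d p).source + c (.forward d p.1) :=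
    congrArg (fun x => p.2 (𝟙 X) + c (.forward d x)) (Functor.map_id_apply (D.obj i) X p.1)
  obtain ⟨i, j, d, p, rfl | rfl⟩ := t.exists_eq_forward_or_reverse
  · exact sheet_forward d p
  · exact eq_add_neg_of_add_eq (sheet_forward d p).symm |>.trans (congrArg _ (hc _).symm)

theorem Connects.sheet_eq (hc : ∀ s, c s.reverse = -c s) {e e' : Elem (twist c) X}
    {P : List (PathSegment (twist c) X)} (h : Connects e P e') :
    sheet e' = sheet e + ((P.map (PathSegment.map (twistProj c))).map c).sum := by
  induction P generalizing e with
  | nil =>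
    cases h
    exact (add_zero _).symm
  | cons t P ih =>
    obtain ⟨rfl, h⟩ := h
    rw [ih h, sheet_target hc, List.map_cons, List.map_cons, List.sum_cons, add_assoc]

theorem HasTrivialMonodromy.sum_eq_zero (h : HasTrivialMonodromy (twistProj c))
    (hc : ∀ s, c s.reverse = -c s) {y : Elem D X} {P : List (PathSegment D X)}
    (hP : Connects y P y) : (P.map c).sum = 0 := by
  let e : Elem (twist c) X := ⟨y.1, y.2, 0⟩
  obtain ⟨e', Q, hQ, he', rfl⟩ := (isCartesian_twistProj c).exists_path_lift (e := e) hP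
  obtain rfl : e = e' := h ⟨Q, hQ⟩ he'.symm
  exact left_eq_add.1 (hQ.sheet_eq hc)

open Classical in
/-- The indicator of the segments weakly equal to `s`. With values modulo two it is invariant under
both reversal and negation, hence a voltage. -/
def crossing (s t : PathSegment D X) : ZMod 2 :=
  if s.WeakEq t then 1 else 0

open Classical in
theorem crossing_reverse (s t : PathSegment D X) : crossing s t.reverse = -crossing s t := by
  rw [ZMod.neg_eq_self_mod_two]
  exact if_congr PathSegment.weakEq_reverse_iff rfl rfl

theorem IsProper.sum_crossing {s : PathSegment D X} {P : List (PathSegment D X)}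
    (h : IsProper (s :: P)) : ((s :: P).map (crossing s)).sum = 1 := by
  have crossing_self : crossing s s = 1 := if_pos (.inl rfl)
  have sum_tail : (P.map (crossing s)).sum = 0 :=
    List.sum_eq_zero (List.forall_mem_map.2 fun t ht => if_neg (List.rel_of_pairwise_cons h ht))
  rw [List.map_cons, List.sum_cons, crossing_self, sum_tail, add_zero]

theorem isAcyclic_iff_hasTrivialMonodromy :
    IsAcyclic D ↔ ∀ ⦃E : Diagram I (B ⥤ Type w)⦄ (τ : E ⟶ D), IsCartesian τ →
      HasTrivialMonodromy τ := by
  refine ⟨fun hD E τ => hD.hasTrivialMonodromy, fun h X y P hP hP_proper => ?_⟩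
  cases P with
  | nil => rfl
  | cons s P =>
    have sum_eq_zero : ((s :: P).map (crossing s)).sum = 0 :=
      (h _ (isCartesian_twistProj _)).sum_eq_zero (crossing_reverse s) hP
    exact absurd (hP_proper.sum_crossing.symm.trans sum_eq_zero) one_ne_zero

end Twist

end VKPath

end

theorem theorem3p3 {B : Type w} [CategoryTheory.SmallCategory B] {I : Type w} [Quiver.{w} I]
    (D : VKPath.Diagram I (B ⥤ Type w)) (S : B ⥤ Type w)
    (κ : D ⟶ VKPath.constDiagram.obj S) (hκ : VKPath.IsColimiting κ) :
    VKPath.IsVanKampen κ ↔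
      ∀ (X : B) (i j : I) (z : (D.obj i).obj X) (z' : (D.obj j).obj X),
        ¬ ∃ P Q : List (VKPath.PathSegment D X), P ≠ Q ∧
          (VKPath.Connects ⟨i, z⟩ P ⟨j, z'⟩ ∧ VKPath.IsProper P) ∧
          (VKPath.Connects ⟨i, z⟩ Q ⟨j, z'⟩ ∧ VKPath.IsProper Q) := by
  rw [hκ.isVanKampen_iff_hasTrivialMonodromy, ← VKPath.isAcyclic_iff_hasTrivialMonodromy,
    VKPath.isAcyclic_iff_proper_path_unique]
  constructor
  · rintro h X i j z z' ⟨P, Q, hne, ⟨hP, hP_proper⟩, hQ, hQ_proper⟩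
    exact hne (h hP hP_proper hQ hQ_proper)
  · intro h X ⟨i, z⟩ ⟨j, z'⟩ P Q hP hP_proper hQ hQ_proper
    by_contra hne
    exact h X i j z z' ⟨P, Q, hne, ⟨hP, hP_proper⟩, hQ, hQ_proper⟩
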